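/- Let $0\le n\le 12$ and $P\ge 0$. Let $s,t,v,w$ be the homogeneous coordinates of the Hirzebruch surface $\mathbb F_n$, of classes $[s]=S$ (the $(-n)$-curve), $[t]=S+nV$, $[v]=[w]=V$ (the fiber), and consider a family of Weierstrass models $y^2=x^3+\hat f x+\hat g$ over $\mathbb F_n\times D$ with parameter $u$, where $\hat f,\hat g$ are power series in $u$ whose coefficients are sections over $\mathbb F_n$ of $4\overline K$ and $6\overline K$, $\overline K=2S+(2+n)V$. Let $(f,g)$ be a resolution of this family with central fiber a chain of components $\{e_0=0\},\dots,\{e_P=0\}$, of one of the following two kinds. * Horizontal: for some $0\le c\le P$ one blows up the base $c$ times over the $(+n)$-curve $t=u=0$ and $P-c$ times over the $(-n)$-curve $s=u=0$, i.e. one substitutes $u\mapsto\prod_p e_p$, $s\mapsto s\prod_{p>c}e_p^{p-c}$, $t\mapsto t\prod_{p<c}e_p^{c-p}$ and divides $\hat f$ by $\prod_p e_p^{4|p-c|}$ and $\hat g$ by $\prod_p e_p^{6|p-c|}$ (these quotients $f,g$ being assumed to exist). * Vertical: one blows up $P$ times over the fiber $v=u=0$, i.e. one substitutes $u\mapsto\prod_p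 e_p$, $v\mapsto v\prod_p e_p^{p}$ and divides $\hat f$ by $\prod_p e_p^{4p}$ and $\hat g$ by $\prod_p e_p^{6p}$ (again assumed possible); moreover, as holds in a resolved single infinite-distance limit, for no $p$ do $f$ and $g$ vanish to orders at least $4$ and $6$, respectively, along the curve $s=e_p=0$. Let $\Delta=4f^3+27g^2$ and suppose that for every $p$ the generic elliptic fiber over $e_p=0$ is of Kodaira type $\mathrm I_{n_p}$, i.e. $\Delta$ vanishes to order exactly $n_p<\infty$ along $e_p=0$ and, if $n_p>0$, neither $f$ nor $g$ vanishes identically on $e_p=0$. Write $f_p,g_p$ for the parts of $f,g$ free of $e_p$. Say that the component $p$ comes from * a single accidental cancellation, if $f_p=-3h^2$, $g_p=2h^3$ for some $h$ free of $e_p$ and $n_p=\min(l,m)$, where $l,m\in\mathbb N\cup\{\infty\}$ are the exact orders of $f-f_p$ and $g-g_p$ in $e_p$; * a double accidental cancellation, if $f_p=-3h^2$, $g_p=2h^3$ for some $h$ free of $e_p$, the orders of $f-f_p$ and $g-g_p$ in $e_p$ are equal to the same finite number $r$, and, writing $f-f_p=e_p^r\check f$, $g-g_p=e_p^r\check g$,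 the order $\rho\in\mathbb N\cup\{\infty\}$ of $h\check f+\check g$ in $e_p$ is at least $1$ and $n_p=\min(r+\rho,2r)$. Put $b(n)=8,4,2,1$ for $n\in[0,2],[3,4],[5,8],[9,12]$ respectively. For horizontal models: for $0\le p\le P-1$, if $n_p=0$ or the component $p$ comes from a single or double accidental cancellation, then $n_p-n_{p+1}\le b(n)$; and for $1\le p\le P$, under the same condition on the component $p$, $n_p-n_{p-1}\le 8$. For vertical models, under the same conditions on the component $p$: $n_p-n_{p+1}\le b(n)$ for $0\le p\le P-1$, and $n_p-n_{p-1}\le 2(4+4n)$ for $1\le p\le P$. -/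

import Mathlib

open scoped BigOperators

/-- Homogeneous coordinates of the total space of the (toric) family of bases:
the exceptional coordinates `e 0, …, e P` of the components of the central fibre, the fibre
coordinates `s, t` (`s = 0` is the `(-n)`-curve and `t = 0` a `(+n)`-curve), and the base
coordinates `v, w`. For `P = 0` this is the unresolved family, and `e 0` is the
degeneration parameter `u`. -/
inductive Coord (P : ℕ) : Type
  | e (p : Fin (P + 1))
  | s
  | t
  | v
  | w

instance Coord.finite (P : ℕ) : Finite (Coord P) :=
  Finite.of_injective
    (fun c : Coord P => match c with
      | .e p => (Sum.inl p : Fin (P + 1) ⊕ Fin 4)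
      | .s => Sum.inr 0
      | .t => Sum.inr 1
      | .v => Sum.inr 2
      | .w => Sum.inr 3)
    (by intro a b h; cases a <;> cases b <;> simp_all)

/-- The ring containing the defining polynomials. Sections over a disc are polynomial in
`s, t, v, w` and power series in the degeneration parameter. -/
abbrev CoxRing (P : ℕ) : Type := MvPowerSeries (Coord P) ℂ

noncomputable section

/-- The coordinate `c`, as an element of the Cox ring. -/
def coord {P : ℕ} (c : Coord P) : CoxRing P := MvPowerSeries.X c

/-- `F` is a section of the `k`-th power of the anticanonical bundle
`2 S + (2 + n) V` of the family of Hirzebruch surfaces `𝔽_n × D`, where the classes of the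
coordinates are `[s] = S`, `[t] = S + n V`, `[v] = [w] = V`. Equivalently its monomials are
`u^a s^i t^(2k - i) v^j w^((2 + n) k - (2k - i) n - j)`, all exponents being `≥ 0`. -/
def IsAnticanonicalSection (n k : ℕ) (F : CoxRing 0) : Prop :=
  ∀ d : Coord 0 →₀ ℕ, MvPowerSeries.coeff d F ≠ 0 →
    d .s + d .t = 2 * k ∧ n * d .t + d .v + d .w = (2 + n) * k

/-- The substitution describing the toric resolution of a horizontal model. The component with
index `c` is the strict transform of the original base `𝔽_n × {0}`; the components after `c`
come from `P - c` successive blow-ups over the `(-n)`-curve `s = u = 0`, those before `c` from `c`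
successive blow-ups over the `(+n)`-curve `t = u = 0`. The subtractions are truncated. -/
def horizontalSubst {P : ℕ} (c : Fin (P + 1)) : Coord 0 → CoxRing P
  | .e _ => ∏ p : Fin (P + 1), coord (.e p)
  | .s => coord .s * ∏ p : Fin (P + 1), coord (.e p) ^ ((p : ℕ) - (c : ℕ))
  | .t => coord .t * ∏ p : Fin (P + 1), coord (.e p) ^ ((c : ℕ) - (p : ℕ))
  | .v => coord .v
  | .w => coord .w

/-- The substitution describing the toric resolution of a vertical model: `P` successive
blow-ups over the fibre `v = u = 0`. -/
def verticalSubst (P : ℕ) : Coord 0 → CoxRing P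
  | .e _ => ∏ p : Fin (P + 1), coord (.e p)
  | .s => coord .s
  | .t => coord .t
  | .v => coord .v * ∏ p : Fin (P + 1), coord (.e p) ^ (p : ℕ)
  | .w => coord .w

theorem constantCoeff_prod_coord_e (P : ℕ) :
    MvPowerSeries.constantCoeff (∏ p : Fin (P + 1), (coord (.e p) : CoxRing P)) = 0 := by
  rw [map_prod]
  exact Finset.prod_eq_zero (Finset.mem_univ 0) (MvPowerSeries.constantCoeff_X _)

/-- The substitutions are legitimate for power series. -/
theorem hasSubst_horizontalSubst {P : ℕ} (c : Fin (P + 1)) :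
    MvPowerSeries.HasSubst (horizontalSubst c) := by
  apply MvPowerSeries.hasSubst_of_constantCoeff_zero
  intro x
  cases x with
  | e p => exact constantCoeff_prod_coord_e P
  | s => simp [horizontalSubst, coord]
  | t => simp [horizontalSubst, coord]
  | v => simp [horizontalSubst, coord]
  | w => simp [horizontalSubst, coord]

theorem hasSubst_verticalSubst (P : ℕ) :
    MvPowerSeries.HasSubst (verticalSubst P) := by
  apply MvPowerSeries.hasSubst_of_constantCoeff_zero
  intro x
  cases x with
  | e p => exact constantCoeff_prod_coord_e P
  | s => simp [verticalSubst, coord]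
  | t => simp [verticalSubst, coord]
  | v => simp [verticalSubst, coord]
  | w => simp [verticalSubst, coord]

/-- `F` vanishes to order at least `k` along the codimension-two locus `x = y = 0`. -/
def VanishesToOrder {P : ℕ} (x y : Coord P) (k : ℕ) (F : CoxRing P) : Prop :=
  ∀ d : Coord P →₀ ℕ, MvPowerSeries.coeff d F ≠ 0 → k ≤ d x + d y

/-- `(f, g)` is the resolved Weierstrass model of a horizontal model over `𝔽_n`, with central
fibre a chain of components `0, …, P`: it is obtained from a family of Weierstrass models over
`𝔽_n` by blowing up, `c` times over a `(+n)`-curve and `P - c` times over the `(-n)`-curve of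
the central fibre, each blow-up being accompanied by the line bundle shift that divides `f` by
the fourth and `g` by the sixth power of the exceptional coordinate. -/
def IsHorizontalModel (n : ℕ) {P : ℕ} (f g : CoxRing P) : Prop :=
  ∃ (c : Fin (P + 1)) (f₀ g₀ : CoxRing 0),
    IsAnticanonicalSection n 4 f₀ ∧ IsAnticanonicalSection n 6 g₀ ∧
    MvPowerSeries.subst (horizontalSubst c) f₀ =
      (∏ p : Fin (P + 1), coord (.e p) ^ (4 * Nat.dist p c)) * f ∧
    MvPowerSeries.subst (horizontalSubst c) g₀ =
      (∏ p : Fin (P + 1), coord (.e p) ^ (6 * Nat.dist p c)) * g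

/-- `(f, g)` is the resolved Weierstrass model of a vertical model over `𝔽_n`, with central
fibre a chain of components `0, …, P`: it is obtained from a family of Weierstrass models over
`𝔽_n` by `P` blow-ups over a fibre of the central base `𝔽_n`, each accompanied by the line bundle
shift. The last condition says that the resolved central fibre is free of non-minimal fibres over
the curves `s = e_p = 0`; in a single infinite-distance limit this holds for
every curve in the central base. -/
def IsVerticalModel (n : ℕ) {P : ℕ} (f g : CoxRing P) : Prop :=
  (∃ f₀ g₀ : CoxRing 0,
    IsAnticanonicalSection n 4 f₀ ∧ IsAnticanonicalSection n 6 g₀ ∧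
    MvPowerSeries.subst (verticalSubst P) f₀ =
      (∏ p : Fin (P + 1), coord (.e p) ^ (4 * (p : ℕ))) * f ∧
    MvPowerSeries.subst (verticalSubst P) g₀ =
      (∏ p : Fin (P + 1), coord (.e p) ^ (6 * (p : ℕ))) * g) ∧
  ∀ p : Fin (P + 1),
    ¬ (VanishesToOrder (.e p) .s 4 f ∧ VanishesToOrder (.e p) .s 6 g)

/-- The discriminant of the Weierstrass model `y² = x³ + f x + g`. -/
def discriminant {P : ℕ} (f g : CoxRing P) : CoxRing P := 4 * f ^ 3 + 27 * g ^ 2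

/-- The generic elliptic fibre over the component `e_p = 0` is of Kodaira type `I_m`: the
discriminant vanishes there to order exactly `m`, and if `m > 0` then neither `f` nor `g`
vanishes identically there. -/
def HasGenericFiberI {P : ℕ} (f g : CoxRing P) (p : Fin (P + 1)) (m : ℕ) : Prop :=
  emultiplicity (coord (.e p)) (discriminant f g) = m ∧
  (0 < m → ¬ coord (.e p) ∣ f ∧ ¬ coord (.e p) ∣ g)

/-- The part of `F` without powers of `e_p`, i.e. the restriction of `F` to `e_p = 0`. -/
def restrictE {P : ℕ} (p : Fin (P + 1)) (F : CoxRing P) : CoxRing P :=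
  open Classical in fun d => if d (.e p) = 0 then MvPowerSeries.coeff d F else 0

/-- `f_p = -3 h²` and `g_p = 2 h³`, where `f_p, g_p` are the restrictions to `e_p = 0` and
`h` does not involve `e_p`. -/
def IsCancellationRoot {P : ℕ} (f g : CoxRing P) (p : Fin (P + 1)) (h : CoxRing P) : Prop :=
  restrictE p h = h ∧ restrictE p f = -3 * h ^ 2 ∧ restrictE p g = 2 * h ^ 3

/-- The `I_m` fibres over `e_p = 0` come from a single accidental cancellation: `f_p = -3 h²`,
`g_p = 2 h³`, and there are no further cancellations, so that `m = min (l, l')` for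
the exact powers `l, l'` (possibly `∞`) of `e_p` in `f - f_p` and `g - g_p`. -/
def IsSingleCancellation {P : ℕ} (f g : CoxRing P) (p : Fin (P + 1)) (m : ℕ) : Prop :=
  (∃ h, IsCancellationRoot f g p h) ∧
  (m : ℕ∞) = min (emultiplicity (coord (.e p)) (f - restrictE p f))
    (emultiplicity (coord (.e p)) (g - restrictE p g))

/-- The `I_m` fibres over `e_p = 0` come from a double accidental cancellation: `f_p = -3 h²`,
`g_p = 2 h³`, `f = f_p + e_p^r f'`, `g = g_p + e_p^r g'` with `r` the exact power of `e_p` in both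
cases, and `h f' + g'` is divisible by `e_p`, exactly `ρ ≥ 1` times (`ρ = ∞` if it vanishes).
There are no further cancellations, so that `m = min (r + ρ, 2 r)`. -/
def IsDoubleCancellation {P : ℕ} (f g : CoxRing P) (p : Fin (P + 1)) (m : ℕ) : Prop :=
  ∃ (h f' g' : CoxRing P) (r : ℕ) (ρ : ℕ∞),
    IsCancellationRoot f g p h ∧
    f = coord (.e p) ^ r * f' + restrictE p f ∧ ¬ coord (.e p) ∣ f' ∧
    g = coord (.e p) ^ r * g' + restrictE p g ∧ ¬ coord (.e p) ∣ g' ∧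
    emultiplicity (coord (.e p)) (h * f' + g') = ρ ∧ 1 ≤ ρ ∧
    (m : ℕ∞) = min (r + ρ) (2 * r)

/-- If the component `p` is weakly coupled (`m > 0`), then its `I_m` fibres come from a single or
from a double accidental cancellation. -/
def SingleOrDouble {P : ℕ} (f g : CoxRing P) (p : Fin (P + 1)) (m : ℕ) : Prop :=
  0 < m → IsSingleCancellation f g p m ∨ IsDoubleCancellation f g p m

end

/-- The bound `8, 4, 2, 1` for `n` in `[0,2]`, `[3,4]`, `[5,8]`, `[9,12]`. -/
def forwardBound (n : ℕ) : ℤ :=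
  if n ≤ 2 then 8 else if n ≤ 4 then 4 else if n ≤ 8 then 2 else 1

/-!
Fix a component `p` whose `I_m` fibres, `m > 0`, come from accidental cancellations. Write
`F = f - f_p`, `G = g - g_p` and `H = h F + G`. Since `f_p = -3 h²` and `g_p = 2 h³`, the
discriminant equals

  `108 h³ H - 36 h² F² + 27 (H - h F)² + 4 F³`,

which lies in the ideal `(H, F²)` (`IsCancellationRoot.discriminant_eq`). Single and double
cancellations both mean that `e_p ^ m ∣ H` and `e_p ^ r ∣ F` with `m ≤ 2 r` (`IsCancellation`).

The blow-ups are monomial substitutions, so `f` and `g` are homogeneous for a grading that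
expresses the exponent of `e_{p+1}` in a monomial through that of `e_p` and that of one further
coordinate `x` (`x = s` for horizontal, `x = v` for vertical models): the two exponents differ by
`x`-exponent minus `4` for `f`, minus `6` for `g` (`isGraded_of_subst_horizontal`,
`isGraded_of_subst_vertical`). As `h f_p` is proportional to `g_p` and power series form a domain,
`h` is homogeneous too, and then `H` is homogeneous of the degree of `g`. The possible
exponents of `x` in sections of the anticanonical powers bound how much of the divisibility of `F`
and `H` by `e_p` is lost on a neighbouring component. If it is at most `α` for `F` and at
most `β` for `H`, with `2 α ≤ B` and `β ≤ B`, then the order of the discriminant drops by at most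
`B` (`SingleOrDouble.sub_le`). This gives all bounds but that of vertical models in the forward
direction for `n ≥ 3`.

In that case the order `m` itself is bounded (`IsCancellation.le_forwardBoundNat`). A monomial free
of `e_p` has non-negative exponent of `e_{p+1}`, so `h` is divisible by `v²`, and therefore, by its
degree, by `s²`. Hence `f_p` and `g_p` vanish along `s = 0` to orders `4` and `6`. Minimality along
`s = e_p = 0` then requires a monomial of low order in `F` or in `H`. Since sections over `𝔽_n` have
many factors of `s`, such a monomial leaves little room for powers of `e_p`.
-/

/-! ### Graded power series -/

section Graded

variable {σ A : Type*} [AddCommGroup A]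

/-- `F` is homogeneous of degree `a` for the grading of the monomials by an additive map `φ`
into a group: every monomial occurring in `F` has degree `a`. The degrees may be negative. -/
def IsGraded (φ : (σ →₀ ℕ) →+ A) (a : A) (F : MvPowerSeries σ ℂ) : Prop :=
  ∀ d, MvPowerSeries.coeff d F ≠ 0 → φ d = a

/-- The part of degree `a` of a power series, for the grading `φ`. -/
noncomputable def gradedPart (φ : (σ →₀ ℕ) →+ A) (a : A) (F : MvPowerSeries σ ℂ) :
    MvPowerSeries σ ℂ :=
  open Classical in fun d => if φ d = a then MvPowerSeries.coeff d F else 0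

open Classical in
theorem coeff_gradedPart (φ : (σ →₀ ℕ) →+ A) (a : A) (F : MvPowerSeries σ ℂ) (d : σ →₀ ℕ) :
    MvPowerSeries.coeff d (gradedPart φ a F) =
      if φ d = a then MvPowerSeries.coeff d F else 0 := rfl

theorem exists_coeff_ne_zero_of_coeff_mul_ne_zero {F G : MvPowerSeries σ ℂ} {d : σ →₀ ℕ}
    (h : MvPowerSeries.coeff d (F * G) ≠ 0) :
    ∃ d₁ d₂, d₁ + d₂ = d ∧ MvPowerSeries.coeff d₁ F ≠ 0 ∧ MvPowerSeries.coeff d₂ G ≠ 0 := by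
  classical
  rw [MvPowerSeries.coeff_mul] at h
  obtain ⟨x, hx, hne⟩ := Finset.exists_ne_zero_of_sum_ne_zero h
  exact ⟨x.1, x.2, Finset.HasAntidiagonal.mem_antidiagonal.mp hx, left_ne_zero_of_mul hne,
    right_ne_zero_of_mul hne⟩

variable {φ : (σ →₀ ℕ) →+ A} {a b : A} {F G : MvPowerSeries σ ℂ}

theorem IsGraded.add (hF : IsGraded φ a F) (hG : IsGraded φ a G) : IsGraded φ a (F + G) := by
  intro d hd
  by_cases h : MvPowerSeries.coeff d F = 0
  · exact hG d fun h' => hd (by simp [h, h'])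
  · exact hF d h

theorem IsGraded.sub (hF : IsGraded φ a F) (hG : IsGraded φ a G) : IsGraded φ a (F - G) := by
  intro d hd
  by_cases h : MvPowerSeries.coeff d F = 0
  · exact hG d fun h' => hd (by simp [h, h'])
  · exact hF d h

theorem IsGraded.mul (hF : IsGraded φ a F) (hG : IsGraded φ b G) :
    IsGraded φ (a + b) (F * G) := by
  intro d hd
  obtain ⟨d₁, d₂, rfl, h₁, h₂⟩ := exists_coeff_ne_zero_of_coeff_mul_ne_zero hd
  rw [map_add, hF d₁ h₁, hG d₂ h₂]

theorem IsGraded.C_mul (c : ℂ) (hF : IsGraded φ a F) :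
    IsGraded φ a (MvPowerSeries.C c * F) := by
  intro d hd
  exact hF d fun h => hd (by simp [h])

theorem gradedPart_mul (hG : IsGraded φ b G) :
    gradedPart φ (a + b) (F * G) = gradedPart φ a F * G := by
  classical
  ext d
  rw [coeff_gradedPart, MvPowerSeries.coeff_mul, MvPowerSeries.coeff_mul,
    Finset.ite_sum_zero]
  refine Finset.sum_congr rfl fun x hx => ?_
  rw [coeff_gradedPart, ← Finset.HasAntidiagonal.mem_antidiagonal.mp hx, map_add]
  by_cases h : MvPowerSeries.coeff x.2 G = 0
  · simp [h]
  · simp [hG x.2 h]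

/-- A factor of a homogeneous power series is homogeneous if the complementary factor is:
here the ring of power series is a domain, and the part of `F` of the expected degree has the
same product with `G` as `F`. -/
theorem IsGraded.of_mul_right (hG : IsGraded φ b G) (hG0 : G ≠ 0)
    (hFG : IsGraded φ (a + b) (F * G)) : IsGraded φ a F := by
  have h : gradedPart φ a F = F := by
    apply mul_right_cancel₀ hG0
    rw [← gradedPart_mul hG]
    ext d
    rw [coeff_gradedPart]
    split_ifs with h
    · rfl
    · by_contra h'
      exact h (hFG d (Ne.symm h'))
  intro d hd
  rw [← h, coeff_gradedPart] at hd
  by_contra h'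
  exact hd (if_neg h')

theorem le_of_X_pow_dvd {x : σ} {k : ℕ} (h : (MvPowerSeries.X x : MvPowerSeries σ ℂ) ^ k ∣ F)
    {d : σ →₀ ℕ} (hd : MvPowerSeries.coeff d F ≠ 0) : k ≤ d x := by
  by_contra h'
  exact hd (MvPowerSeries.X_pow_dvd_iff.mp h d (not_le.mp h'))

theorem X_pow_dvd_of_le {x : σ} {k : ℕ} (h : ∀ d, MvPowerSeries.coeff d F ≠ 0 → k ≤ d x) :
    (MvPowerSeries.X x : MvPowerSeries σ ℂ) ^ k ∣ F := by
  rw [MvPowerSeries.X_pow_dvd_iff]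
  intro d hd
  by_contra h'
  exact absurd (h d h') (not_le.mpr hd)

/-- If on monomials of degree `a` the exponent of `y` is at least that of `x` minus `k`, then
divisibility by a power of `x` carries over to `y`, up to `k`. -/
theorem IsGraded.X_pow_dvd {x y : σ} {k m l : ℕ} (hF : IsGraded φ a F)
    (hxy : ∀ d, φ d = a → d x ≤ d y + k) (hl : l ≤ m - k)
    (h : (MvPowerSeries.X x : MvPowerSeries σ ℂ) ^ m ∣ F) :
    (MvPowerSeries.X y : MvPowerSeries σ ℂ) ^ l ∣ F := by
  refine X_pow_dvd_of_le fun d hd => ?_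
  have h₁ := le_of_X_pow_dvd h hd
  have h₂ := hxy d (hF d hd)
  omega

end Graded

/-! ### Restriction to a component and accidental cancellations -/

section Cancellation

variable {P : ℕ} {p : Fin (P + 1)} {f g : CoxRing P}

open Classical in
theorem coeff_restrictE (F : CoxRing P) (d : Coord P →₀ ℕ) :
    MvPowerSeries.coeff d (restrictE p F) =
      if d (.e p) = 0 then MvPowerSeries.coeff d F else 0 := rfl

theorem IsGraded.restrictE {A : Type*} [AddCommGroup A] {φ : (Coord P →₀ ℕ) →+ A} {a : A}
    {F : CoxRing P} (hF : IsGraded φ a F) : IsGraded φ a (restrictE p F) := by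
  intro d hd
  rw [coeff_restrictE] at hd
  exact hF d fun h => hd (by simp [h])

theorem coord_dvd_sub_restrictE (F : CoxRing P) : coord (.e p) ∣ F - restrictE p F := by
  rw [coord, MvPowerSeries.X_dvd_iff]
  intro d hd
  simp [coeff_restrictE, hd]

/-- A common consequence of single and double cancellations, in which `r` bounds the order of
`f - f_p` from below: `m ≤ 2 r`, and `m` is at most the order of `h (f - f_p) + (g - g_p)`, the
first-order variation of the discriminant up to the factor `108 h³`. -/
def IsCancellation (f g : CoxRing P) (p : Fin (P + 1)) (m r : ℕ) (h : CoxRing P) : Prop :=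
  IsCancellationRoot f g p h ∧ m ≤ 2 * r ∧
    coord (.e p) ^ r ∣ f - restrictE p f ∧
    coord (.e p) ^ m ∣ h * (f - restrictE p f) + (g - restrictE p g)

theorem SingleOrDouble.exists_isCancellation {m : ℕ} (hs : SingleOrDouble f g p m) (hm : 0 < m) :
    ∃ r h, IsCancellation f g p m r h := by
  rcases hs hm with ⟨⟨h, hr⟩, hmin⟩ | ⟨h, f', g', r, ρ, hr, hf, -, hg, -, hρ, -, hmin⟩
  · have hf : coord (.e p) ^ m ∣ f - restrictE p f :=
      pow_dvd_of_le_emultiplicity (hmin ▸ min_le_left _ _)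
    have hg : coord (.e p) ^ m ∣ g - restrictE p g :=
      pow_dvd_of_le_emultiplicity (hmin ▸ min_le_right _ _)
    exact ⟨m, h, hr, by omega, hf, dvd_add (hf.mul_left h) hg⟩
  · have hf' : f - restrictE p f = coord (.e p) ^ r * f' := by
      nth_rewrite 1 [hf]; ring
    have hg' : g - restrictE p g = coord (.e p) ^ r * g' := by
      nth_rewrite 1 [hg]; ring
    have h2r : m ≤ 2 * r := by
      have : (m : ℕ∞) ≤ 2 * r := hmin ▸ min_le_right _ _
      exact_mod_cast this
    refine ⟨r, h, hr, h2r, ⟨f', hf'⟩, ?_⟩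
    have hk : coord (.e p) ^ (m - r) ∣ h * f' + g' := by
      apply pow_dvd_of_le_emultiplicity
      rw [hρ]
      have : (m : ℕ∞) ≤ r + ρ := hmin ▸ min_le_left _ _
      rw [ENat.natCast_sub]
      exact tsub_le_iff_left.mpr this
    have he : h * (f - restrictE p f) + (g - restrictE p g) =
        coord (.e p) ^ r * (h * f' + g') := by
      rw [hf', hg']; ring
    rw [he]
    refine (pow_dvd_pow _ (by omega : m ≤ r + (m - r))).trans ?_
    rw [pow_add]
    exact mul_dvd_mul_left _ hk

/-- The discriminant lies in the ideal generated by `H = h F + G` and `F²`, for `F = f - f_p` and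
`G = g - g_p`. -/
theorem IsCancellationRoot.discriminant_eq {h : CoxRing P} (hr : IsCancellationRoot f g p h) :
    discriminant f g =
      (h * (f - restrictE p f) + (g - restrictE p g)) *
        (108 * h ^ 3 + 27 * (g - restrictE p g) - 27 * h * (f - restrictE p f)) +
      (f - restrictE p f) ^ 2 * (4 * (f - restrictE p f) - 9 * h ^ 2) := by
  obtain ⟨-, hf, hg⟩ := hr
  obtain ⟨F, hF⟩ : ∃ F, F = f - restrictE p f := ⟨_, rfl⟩
  obtain ⟨G, hG⟩ : ∃ G, G = g - restrictE p g := ⟨_, rfl⟩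
  have hf' : f = -3 * h ^ 2 + F := by rw [hF, ← hf]; ring
  have hg' : g = 2 * h ^ 3 + G := by rw [hG, ← hg]; ring
  rw [← hF, ← hG, discriminant, hf', hg']
  ring

variable {A : Type*} [AddCommGroup A] {φ : (Coord P →₀ ℕ) →+ A} {δ : A}

/-- The root `h` is homogeneous because `h f_p = -(3/2) g_p`. -/
theorem IsCancellationRoot.isGraded {h : CoxRing P} (hr : IsCancellationRoot f g p h)
    (hf : IsGraded φ (4 • δ) f) (hg : IsGraded φ (6 • δ) g) (hdvd : ¬ coord (.e p) ∣ f) :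
    IsGraded φ (2 • δ) h := by
  obtain ⟨-, hfp, hgp⟩ := hr
  have hf0 : restrictE p f ≠ 0 := by
    intro h0
    have := coord_dvd_sub_restrictE (p := p) f
    rw [h0, sub_zero] at this
    exact hdvd this
  refine IsGraded.of_mul_right (b := 4 • δ) hf.restrictE hf0 ?_
  have he : h * restrictE p f = MvPowerSeries.C (-3 / 2 : ℂ) * restrictE p g := by
    have h2 : (MvPowerSeries.C (-3 / 2 : ℂ) : CoxRing P) * 2 = -3 := by
      rw [← map_ofNat (MvPowerSeries.C (σ := Coord P) (R := ℂ)) 2, ← map_mul,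
        ← map_ofNat (MvPowerSeries.C (σ := Coord P) (R := ℂ)) 3, ← map_neg]
      norm_num
    rw [hfp, hgp, ← mul_assoc (MvPowerSeries.C _), h2]
    ring
  rw [he, ← add_smul]
  exact hg.restrictE.C_mul _

/-- The comparison of two components `p` and `q`: if on the monomials of `f` and of `g` the
exponent of `e_q` is at least that of `e_p` minus `α` and `β`, respectively, then the order of the
discriminant drops by at most `B` from `e_p` to `e_q`. -/
theorem IsCancellation.pow_dvd_discriminant {q : Fin (P + 1)} {m r α β B : ℕ} {h : CoxRing P}
    (hc : IsCancellation f g p m r h)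
    (hf : IsGraded φ (4 • δ) f) (hg : IsGraded φ (6 • δ) g) (hdvd : ¬ coord (.e p) ∣ f)
    (hα : ∀ d, φ d = 4 • δ → d (.e p) ≤ d (.e q) + α)
    (hβ : ∀ d, φ d = 6 • δ → d (.e p) ≤ d (.e q) + β) (hαB : 2 * α ≤ B) (hβB : β ≤ B) :
    coord (.e q) ^ (m - B) ∣ discriminant f g := by
  obtain ⟨hr, hm, hF, hH⟩ := hc
  have hFg : IsGraded φ (4 • δ) (f - restrictE p f) := hf.sub hf.restrictE
  have hGg : IsGraded φ (6 • δ) (g - restrictE p g) := hg.sub hg.restrictE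
  have hHg : IsGraded φ (6 • δ) (h * (f - restrictE p f) + (g - restrictE p g)) := by
    refine IsGraded.add ?_ hGg
    have := (hr.isGraded hf hg hdvd).mul hFg
    rwa [← add_smul] at this
  have hF' : coord (.e q) ^ (r - α) ∣ f - restrictE p f :=
    hFg.X_pow_dvd hα le_rfl hF
  have hH' : coord (.e q) ^ (m - B) ∣ h * (f - restrictE p f) + (g - restrictE p g) :=
    hHg.X_pow_dvd hβ (by omega) hH
  rw [hr.discriminant_eq]
  refine dvd_add (hH'.mul_right _) (Dvd.dvd.mul_right ?_ _)
  have := pow_dvd_pow_of_dvd hF' 2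
  rw [← pow_mul] at this
  exact (pow_dvd_pow _ (by omega)).trans this

/-- The bound for two components whose exponents are related as in
`IsCancellation.pow_dvd_discriminant`. -/
theorem SingleOrDouble.sub_le {q : Fin (P + 1)} {m k α β B : ℕ}
    (hs : SingleOrDouble f g p m)
    (hp : HasGenericFiberI f g p m) (hq : HasGenericFiberI f g q k)
    (hf : IsGraded φ (4 • δ) f) (hg : IsGraded φ (6 • δ) g)
    (hα : ∀ d, φ d = 4 • δ → d (.e p) ≤ d (.e q) + α)
    (hβ : ∀ d, φ d = 6 • δ → d (.e p) ≤ d (.e q) + β) (hαB : 2 * α ≤ B) (hβB : β ≤ B) :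
    (m : ℤ) - k ≤ B := by
  rcases Nat.eq_zero_or_pos m with rfl | hm
  · push_cast; linarith [Int.natCast_nonneg k, Int.natCast_nonneg B]
  obtain ⟨r, h, hc⟩ := hs.exists_isCancellation hm
  have hd := le_emultiplicity_of_pow_dvd
    (hc.pow_dvd_discriminant hf hg (hp.2 hm).1 hα hβ hαB hβB)
  rw [hq.1] at hd
  have : m - B ≤ k := by exact_mod_cast hd
  omega

end Cancellation

/-! ### The monomials of the resolved models -/

section Substitution

variable {P : ℕ}

/-- The exponent vector of `∏ p, e_p ^ k p`. -/
noncomputable def eExponent (k : Fin (P + 1) → ℕ) : Coord P →₀ ℕ :=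
  ∑ p, Finsupp.single (.e p) (k p)

theorem prod_coord_e_pow (k : Fin (P + 1) → ℕ) :
    ∏ p, (coord (.e p) : CoxRing P) ^ k p = MvPowerSeries.monomial (eExponent k) 1 := by
  simp only [coord, MvPowerSeries.X_pow_eq, MvPowerSeries.prod_monomial, eExponent,
    Finset.prod_const_one]

theorem prod_coord_e :
    ∏ p, (coord (.e p) : CoxRing P) = MvPowerSeries.monomial (eExponent fun _ => 1) 1 := by
  rw [← prod_coord_e_pow]
  simp only [pow_one]

theorem coord_eq_monomial (x : Coord P) :
    (coord x : CoxRing P) = MvPowerSeries.monomial (Finsupp.single x 1) 1 := rfl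

@[simp]
theorem eExponent_apply_e (k : Fin (P + 1) → ℕ) (q : Fin (P + 1)) :
    eExponent k (.e q) = k q := by
  classical
  simp [eExponent, Finsupp.finsetSum_apply, Finsupp.single_apply]

@[simp]
theorem eExponent_apply_s (k : Fin (P + 1) → ℕ) : eExponent k .s = 0 := by
  simp [eExponent, Finsupp.finsetSum_apply]

@[simp]
theorem eExponent_apply_t (k : Fin (P + 1) → ℕ) : eExponent k .t = 0 := by
  simp [eExponent, Finsupp.finsetSum_apply]

@[simp]
theorem eExponent_apply_v (k : Fin (P + 1) → ℕ) : eExponent k .v = 0 := by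
  simp [eExponent, Finsupp.finsetSum_apply]

@[simp]
theorem eExponent_apply_w (k : Fin (P + 1) → ℕ) : eExponent k .w = 0 := by
  simp [eExponent, Finsupp.finsetSum_apply]

theorem Coord.sum_smul_eq {M : Type*} [AddCommMonoid M] (d : Coord 0 →₀ ℕ) (V : Coord 0 → M) :
    (d.sum fun x k => k • V x) =
      d (.e 0) • V (.e 0) + d .s • V .s + d .t • V .t + d .v • V .v + d .w • V .w := by
  classical
  induction d using Finsupp.induction_linear with
  | zero => simp
  | add d₁ d₂ h₁ h₂ =>
    rw [Finsupp.sum_add_index' (by simp) (by intros; rw [add_smul]), h₁, h₂]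
    simp only [Finsupp.add_apply, add_smul]
    abel
  | single x k =>
    rw [Finsupp.sum_single_index (by simp)]
    cases x with
    | e p => obtain rfl : p = 0 := Fin.eq_zero p; simp
    | s => simp
    | t => simp
    | v => simp
    | w => simp

/-- The monomials of the quotient `F` of a monomial substitution in `F₀` by a monomial `m` come
from monomials of `F₀`. -/
theorem exists_coeff_ne_zero_of_subst_eq_monomial_mul {a : Coord 0 → CoxRing P}
    (ha : MvPowerSeries.HasSubst a) {V : Coord 0 → (Coord P →₀ ℕ)}
    (hV : ∀ x, a x = MvPowerSeries.monomial (V x) 1) {F₀ : CoxRing 0} {m : Coord P →₀ ℕ}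
    {F : CoxRing P} (h : MvPowerSeries.subst a F₀ = MvPowerSeries.monomial m 1 * F)
    {d : Coord P →₀ ℕ} (hd : MvPowerSeries.coeff d F ≠ 0) :
    ∃ d₀ : Coord 0 →₀ ℕ, MvPowerSeries.coeff d₀ F₀ ≠ 0 ∧
      m + d = d₀ (.e 0) • V (.e 0) + d₀ .s • V .s + d₀ .t • V .t + d₀ .v • V .v + d₀ .w • V .w := by
  classical
  have h1 : MvPowerSeries.coeff (m + d) (MvPowerSeries.subst a F₀) ≠ 0 := by
    rwa [h, MvPowerSeries.coeff_add_monomial_mul, one_mul]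
  rw [MvPowerSeries.coeff_subst ha] at h1
  obtain ⟨d₀, h₀⟩ := not_forall.mp (mt finsum_eq_zero_of_forall_eq_zero h1)
  refine ⟨d₀, left_ne_zero_of_mul h₀, ?_⟩
  have h2 := right_ne_zero_of_mul h₀
  simp only [hV, MvPowerSeries.monomial_pow, one_pow, Finsupp.prod,
    MvPowerSeries.prod_monomial, Finset.prod_const_one, MvPowerSeries.coeff_monomial] at h2
  rw [← Coord.sum_smul_eq]
  by_contra h3
  exact h2 (if_neg h3)

/-- The grading of monomials that controls the passage from the component `p` to `p + 1`. Its
first entry compares the exponents of `e_p` and `e_{p+1}` with that of the coordinate `x` over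
which the blow-ups take place; the others are the two gradings of the Hirzebruch surface. -/
def chainWeight (n : ℕ) (p : Fin P) (x : Coord P) : (Coord P →₀ ℕ) →+ ℤ × ℤ × ℤ where
  toFun d := ((d (.e p.succ) : ℤ) - d (.e p.castSucc) - d x, (d .s : ℤ) + d .t,
    n * (d .t : ℤ) + d .v + d .w)
  map_zero' := by simp
  map_add' d₁ d₂ := by
    simp only [Finsupp.add_apply, Prod.mk_add_mk, Prod.mk.injEq]
    push_cast
    exact ⟨by ring, by ring, by ring⟩

/-- The degree for `chainWeight` of a section of the anticanonical bundle. -/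
def anticanonicalWeight (n : ℕ) : ℤ × ℤ × ℤ := (-1, 2, 2 + n)

theorem chainWeight_eq_iff {n : ℕ} {p : Fin P} {x : Coord P} {k : ℕ} {d : Coord P →₀ ℕ} :
    chainWeight n p x d = k • anticanonicalWeight n ↔
      d (.e p.succ) + k = d (.e p.castSucc) + d x ∧ d .s + d .t = 2 * k ∧
        n * d .t + d .v + d .w = (2 + n) * k := by
  simp only [chainWeight, anticanonicalWeight, AddMonoidHom.coe_mk, ZeroHom.coe_mk,
    Prod.smul_mk, Prod.mk.injEq, nsmul_eq_mul]
  zify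
  refine and_congr ?_ (and_congr ?_ ?_) <;> constructor <;> intro h <;> linarith

theorem isGraded_of_subst_horizontal {n k : ℕ} {c : Fin (P + 1)} {F₀ : CoxRing 0}
    {F : CoxRing P} (h₀ : IsAnticanonicalSection n k F₀)
    (h : MvPowerSeries.subst (horizontalSubst c) F₀ =
      (∏ p : Fin (P + 1), coord (.e p) ^ (k * Nat.dist p c)) * F) (p : Fin P) :
    IsGraded (chainWeight n p .s) (k • anticanonicalWeight n) F := by
  intro d hd
  rw [prod_coord_e_pow] at h
  obtain ⟨d₀, hd₀, he⟩ := exists_coeff_ne_zero_of_subst_eq_monomial_mul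
    (hasSubst_horizontalSubst c)
    (V := fun
      | .e _ => eExponent fun _ => 1
      | .s => Finsupp.single .s 1 + eExponent fun q => (q : ℕ) - c
      | .t => Finsupp.single .t 1 + eExponent fun q => (c : ℕ) - q
      | .v => Finsupp.single .v 1
      | .w => Finsupp.single .w 1)
    (by
      intro x
      cases x <;> simp only [horizontalSubst, prod_coord_e, prod_coord_e_pow, coord_eq_monomial .s,
        coord_eq_monomial .t, coord_eq_monomial .v, coord_eq_monomial .w,
        MvPowerSeries.monomial_mul_monomial, mul_one])
    h hd
  obtain ⟨h₁, h₂⟩ := h₀ d₀ hd₀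
  have hs := DFunLike.congr_fun he .s
  have ht := DFunLike.congr_fun he .t
  have hv := DFunLike.congr_fun he .v
  have hw := DFunLike.congr_fun he .w
  have hp := DFunLike.congr_fun he (.e p.castSucc)
  have hq := DFunLike.congr_fun he (.e p.succ)
  simp [Nat.dist] at hs ht hv hw hp hq
  rw [chainWeight_eq_iff, hs, ht, hv, hw]
  refine ⟨?_, h₁, h₂⟩
  rcases le_or_gt (c : ℕ) p with hc | hc
  · obtain ⟨x, hx⟩ := Nat.exists_eq_add_of_le hc
    simp only [hx, show (c : ℕ) + x - c = x by omega, show (c : ℕ) - (c + x) = 0 by omega,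
      show (c : ℕ) + x + 1 - c = x + 1 by omega, show (c : ℕ) - (c + x + 1) = 0 by omega] at hp hq
    linarith
  · obtain ⟨x, hx⟩ := Nat.exists_eq_add_of_lt hc
    simp only [hx, show (p : ℕ) - (p + x + 1) = 0 by omega,
      show (p : ℕ) + x + 1 - p = x + 1 by omega, show (p : ℕ) + 1 - (p + x + 1) = 0 by omega,
      show (p : ℕ) + x + 1 - (p + 1) = x by omega] at hp hq
    linarith

theorem isGraded_of_subst_vertical {n k : ℕ} {F₀ : CoxRing 0}
    {F : CoxRing P} (h₀ : IsAnticanonicalSection n k F₀)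
    (h : MvPowerSeries.subst (verticalSubst P) F₀ =
      (∏ p : Fin (P + 1), coord (.e p) ^ (k * (p : ℕ))) * F) (p : Fin P) :
    IsGraded (chainWeight n p .v) (k • anticanonicalWeight n) F := by
  intro d hd
  rw [prod_coord_e_pow] at h
  obtain ⟨d₀, hd₀, he⟩ := exists_coeff_ne_zero_of_subst_eq_monomial_mul
    (hasSubst_verticalSubst P)
    (V := fun
      | .e _ => eExponent fun _ => 1
      | .s => Finsupp.single .s 1
      | .t => Finsupp.single .t 1
      | .v => Finsupp.single .v 1 + eExponent fun q => (q : ℕ)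
      | .w => Finsupp.single .w 1)
    (by
      intro x
      cases x <;> simp only [verticalSubst, prod_coord_e, prod_coord_e_pow, coord_eq_monomial .s,
        coord_eq_monomial .t, coord_eq_monomial .v, coord_eq_monomial .w,
        MvPowerSeries.monomial_mul_monomial, mul_one])
    h hd
  obtain ⟨h₁, h₂⟩ := h₀ d₀ hd₀
  have hs := DFunLike.congr_fun he .s
  have ht := DFunLike.congr_fun he .t
  have hv := DFunLike.congr_fun he .v
  have hw := DFunLike.congr_fun he .w
  have hp := DFunLike.congr_fun he (.e p.castSucc)
  have hq := DFunLike.congr_fun he (.e p.succ)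
  simp at hs ht hv hw hp hq
  rw [chainWeight_eq_iff, hs, ht, hv, hw]
  refine ⟨?_, h₁, h₂⟩
  linarith

end Substitution

/-! ### Numerical bounds on the sections of the anticanonical powers -/

section Numerics

/-- `forwardBound` as a natural number. -/
def forwardBoundNat (n : ℕ) : ℕ :=
  if n ≤ 2 then 8 else if n ≤ 4 then 4 else if n ≤ 8 then 2 else 1

/-- An upper bound for `6 - i` over the monomials `s^i t^(12 - i) ⋯` of sections of the sixth
anticanonical power, hence for the drop of the exponent from `e_p` to `e_{p+1}` in a monomial of
`g` in a horizontal model. -/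
def forwardDropSix (n : ℕ) : ℕ :=
  if n ≤ 2 then 6 else if n ≤ 4 then 4 else if n ≤ 8 then 2 else 1

theorem natCast_forwardBoundNat (n : ℕ) : (forwardBoundNat n : ℤ) = forwardBound n := by
  unfold forwardBoundNat forwardBound
  split_ifs <;> rfl

/-- A section of the fourth anticanonical power vanishes along the `(-n)`-curve to order at least
`4 - ⌊b(n) / 2⌋`, where `b(n)` is `forwardBound n`. -/
theorem four_le_add_of_section_four {n i j k l : ℕ} (h₁ : i + j = 8)
    (h₂ : n * j + k + l = (2 + n) * 4) : 4 ≤ i + forwardBoundNat n / 2 := by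
  unfold forwardBoundNat
  by_contra h
  have hi : i < 4 := by omega
  have hj : j = 8 - i := by omega
  subst hj
  split_ifs at h <;> interval_cases i <;> omega

theorem six_le_add_of_section_six {n i j k l : ℕ} (h₁ : i + j = 12)
    (h₂ : n * j + k + l = (2 + n) * 6) : 6 ≤ i + forwardDropSix n := by
  unfold forwardDropSix
  by_contra h
  have hi : i < 6 := by omega
  have hj : j = 12 - i := by omega
  subst hj
  split_ifs at h <;> interval_cases i <;> omega

theorem two_mul_forwardBoundNat_half_le (n : ℕ) : 2 * (forwardBoundNat n / 2) ≤ forwardBoundNat n :=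
  Nat.mul_div_le _ _

theorem forwardDropSix_le (n : ℕ) : forwardDropSix n ≤ forwardBoundNat n := by
  unfold forwardDropSix forwardBoundNat
  split_ifs <;> norm_num

/-- A monomial of a section of the sixth anticanonical power of order less than `6` along
`s = e = 0` has a small exponent `x` of `e`. -/
theorem le_forwardBoundNat_of_section_six {n i j k l x : ℕ} (hn : 2 < n) (h₁ : i + j = 12)
    (h₂ : n * j + k + l = (2 + n) * 6) (hx : x + i < 6) : x ≤ forwardBoundNat n := by
  have h₃ := six_le_add_of_section_six h₁ h₂
  unfold forwardDropSix at h₃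
  unfold forwardBoundNat
  split_ifs at h₃ ⊢ <;> omega

theorem two_mul_le_forwardBoundNat_of_section_four {n i j k l x : ℕ} (hn : 2 < n)
    (h₁ : i + j = 8) (h₂ : n * j + k + l = (2 + n) * 4) (hx : x + i < 4) :
    2 * x ≤ forwardBoundNat n := by
  have h₃ := four_le_add_of_section_four h₁ h₂
  unfold forwardBoundNat at h₃ ⊢
  split_ifs at h₃ ⊢ <;> omega

end Numerics

/-! ### Non-minimality in vertical models -/

section Vertical

variable {n P : ℕ} {p : Fin P} {f g : CoxRing P}

/-- Where a further component follows `e_p = 0` in a vertical model over `𝔽_n`, `n ≥ 3`, the root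
`h` of an accidental cancellation vanishes to order `2` along the `(-n)`-curve: its monomials
contain `v²`, which leaves degree at most `2 + 2n` for `t`. -/
theorem IsCancellationRoot.two_le_apply_s {h : CoxRing P} (hn : 2 < n)
    (hr : IsCancellationRoot f g p.castSucc h)
    (hh : IsGraded (chainWeight n p .v) (2 • anticanonicalWeight n) h)
    {d : Coord P →₀ ℕ} (hd : MvPowerSeries.coeff d h ≠ 0) : 2 ≤ d .s := by
  have he : d (.e p.castSucc) = 0 := by
    rw [← hr.1, coeff_restrictE] at hd
    by_contra h0
    exact hd (if_neg h0)
  obtain ⟨h₁, h₂, h₃⟩ := chainWeight_eq_iff.mp (hh d hd)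
  by_contra hs
  have : n * 3 ≤ n * d .t := Nat.mul_le_mul_left _ (by omega)
  omega

/-- In a vertical model over `𝔽_n`, `n ≥ 3`, the vanishing of `f_p` and `g_p` to orders `4` and `6`
along `s = 0` must be compensated by monomials of `f` or `g` with a low power of `e_p`; these
bound the number of cancellations. -/
theorem IsCancellation.le_forwardBoundNat {m r : ℕ} {h : CoxRing P} (hn : 2 < n)
    (hc : IsCancellation f g p.castSucc m r h)
    (hf : IsGraded (chainWeight n p .v) (4 • anticanonicalWeight n) f)
    (hg : IsGraded (chainWeight n p .v) (6 • anticanonicalWeight n) g)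
    (hdvd : ¬ coord (.e p.castSucc) ∣ f)
    (hmin : ¬ (VanishesToOrder (.e p.castSucc) .s 4 f ∧ VanishesToOrder (.e p.castSucc) .s 6 g)) :
    m ≤ forwardBoundNat n := by
  obtain ⟨hr, hm, hF, hH⟩ := hc
  have hh := hr.isGraded hf hg hdvd
  have hs : coord .s ^ 2 ∣ h := X_pow_dvd_of_le fun d hd => hr.two_le_apply_s hn hh hd
  have hFg : IsGraded (chainWeight n p .v) (4 • anticanonicalWeight n)
      (f - restrictE p.castSucc f) := hf.sub hf.restrictE
  have hHg : IsGraded (chainWeight n p .v) (6 • anticanonicalWeight n)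
      (h * (f - restrictE p.castSucc f) + (g - restrictE p.castSucc g)) := by
    refine IsGraded.add ?_ (hg.sub hg.restrictE)
    have := hh.mul hFg
    rwa [← add_smul] at this
  have key : ∀ d, MvPowerSeries.coeff d (f - restrictE p.castSucc f) ≠ 0 →
      d (.e p.castSucc) + d .s < 4 → m ≤ forwardBoundNat n := by
    intro d hd hlt
    obtain ⟨-, h₂, h₃⟩ := chainWeight_eq_iff.mp (hFg d hd)
    have h₄ := two_mul_le_forwardBoundNat_of_section_four hn h₂ h₃ hlt
    have h₅ := le_of_X_pow_dvd hF hd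
    omega
  rw [not_and_or] at hmin
  simp only [VanishesToOrder, not_forall, not_le] at hmin
  rcases hmin with ⟨d, hd, hlt⟩ | ⟨d, hd, hlt⟩
  · refine key d (fun h0 => hd ?_) hlt
    have h4 : (MvPowerSeries.X .s : CoxRing P) ^ 4 ∣ restrictE p.castSucc f := by
      rw [hr.2.1]
      refine Dvd.dvd.mul_left ?_ _
      have := pow_dvd_pow_of_dvd hs 2
      rwa [← pow_mul] at this
    have h5 := MvPowerSeries.X_pow_dvd_iff.mp h4 d (by omega)
    rw [map_sub, h5, sub_zero] at h0
    exact h0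
  · have h6 : (MvPowerSeries.X .s : CoxRing P) ^ 6 ∣ restrictE p.castSucc g := by
      rw [hr.2.2]
      refine Dvd.dvd.mul_left ?_ _
      have := pow_dvd_pow_of_dvd hs 3
      rwa [← pow_mul] at this
    have h7 := MvPowerSeries.X_pow_dvd_iff.mp h6 d (by omega)
    by_cases hHd : MvPowerSeries.coeff d
        (h * (f - restrictE p.castSucc f) + (g - restrictE p.castSucc g)) = 0
    · -- The monomial occurs in `h * (f - f_p)`, and `h` accounts for two powers of `s`.
      have hne : MvPowerSeries.coeff d (h * (f - restrictE p.castSucc f)) ≠ 0 := by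
        intro h0
        rw [map_add, h0, zero_add, map_sub, h7, sub_zero] at hHd
        exact hd hHd
      obtain ⟨d₁, d₂, rfl, hd₁, hd₂⟩ := exists_coeff_ne_zero_of_coeff_mul_ne_zero hne
      have := hr.two_le_apply_s hn hh hd₁
      rw [Finsupp.add_apply, Finsupp.add_apply] at hlt
      exact key d₂ hd₂ (by omega)
    · obtain ⟨-, h₂, h₃⟩ := chainWeight_eq_iff.mp (hHg d hHd)
      exact (le_of_X_pow_dvd hH hHd).trans (le_forwardBoundNat_of_section_six hn h₂ h₃ hlt)

theorem SingleOrDouble.sub_le_forwardBoundNat_of_vertical {m k : ℕ}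
    (hs : SingleOrDouble f g p.castSucc m)
    (hp : HasGenericFiberI f g p.castSucc m) (hq : HasGenericFiberI f g p.succ k)
    (hf : IsGraded (chainWeight n p .v) (4 • anticanonicalWeight n) f)
    (hg : IsGraded (chainWeight n p .v) (6 • anticanonicalWeight n) g)
    (hmin : ¬ (VanishesToOrder (.e p.castSucc) .s 4 f ∧ VanishesToOrder (.e p.castSucc) .s 6 g)) :
    (m : ℤ) - k ≤ forwardBoundNat n := by
  rcases le_or_gt n 2 with hn | hn
  · have hB : forwardBoundNat n = 8 := if_pos hn
    rw [hB]
    refine hs.sub_le hp hq hf hg (α := 4) (β := 6) ?_ ?_ (by norm_num) (by norm_num) <;>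
    · intro d hd
      have := (chainWeight_eq_iff.mp hd).1
      omega
  · rcases Nat.eq_zero_or_pos m with rfl | hm
    · omega
    · obtain ⟨r, h, hc⟩ := hs.exists_isCancellation hm
      have := hc.le_forwardBoundNat hn hf hg (hp.2 hm).1 hmin
      omega

end Vertical

/-! ### The bounds on neighbouring components -/

theorem mainTheorem3 (n P : ℕ) (hn : n ≤ 12) (f g : CoxRing P) (N : Fin (P + 1) → ℕ)
    (hN : ∀ p, HasGenericFiberI f g p (N p)) :
    (IsHorizontalModel n f g →
      (∀ p : Fin P, SingleOrDouble f g p.castSucc (N p.castSucc) →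
        (N p.castSucc : ℤ) - N p.succ ≤ forwardBound n) ∧
      (∀ p : Fin P, SingleOrDouble f g p.succ (N p.succ) →
        (N p.succ : ℤ) - N p.castSucc ≤ 8)) ∧
    (IsVerticalModel n f g →
      (∀ p : Fin P, SingleOrDouble f g p.castSucc (N p.castSucc) →
        (N p.castSucc : ℤ) - N p.succ ≤ forwardBound n) ∧
      (∀ p : Fin P, SingleOrDouble f g p.succ (N p.succ) →
        (N p.succ : ℤ) - N p.castSucc ≤ 2 * (4 + 4 * n))) := by
  rw [← natCast_forwardBoundNat]
  constructor
  · rintro ⟨c, f₀, g₀, hf₀, hg₀, hf, hg⟩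
    have hf := isGraded_of_subst_horizontal hf₀ hf
    have hg := isGraded_of_subst_horizontal hg₀ hg
    refine ⟨fun p hs => ?_, fun p hs => ?_⟩
    · refine hs.sub_le (hN _) (hN _) (hf p) (hg p) (α := forwardBoundNat n / 2)
        (β := forwardDropSix n) ?_ ?_ (two_mul_forwardBoundNat_half_le n) (forwardDropSix_le n)
      · intro d hd
        obtain ⟨h₁, h₂, h₃⟩ := chainWeight_eq_iff.mp hd
        have := four_le_add_of_section_four h₂ h₃
        omega
      · intro d hd
        obtain ⟨h₁, h₂, h₃⟩ := chainWeight_eq_iff.mp hd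
        have := six_le_add_of_section_six h₂ h₃
        omega
    · refine hs.sub_le (B := 8) (hN _) (hN _) (hf p) (hg p) (α := 4) (β := 6) ?_ ?_
        (by norm_num) (by norm_num) <;>
      · intro d hd
        obtain ⟨h₁, h₂, -⟩ := chainWeight_eq_iff.mp hd
        omega
  · rintro ⟨⟨f₀, g₀, hf₀, hg₀, hf, hg⟩, hmin⟩
    have hf := isGraded_of_subst_vertical hf₀ hf
    have hg := isGraded_of_subst_vertical hg₀ hg
    refine ⟨fun p hs => hs.sub_le_forwardBoundNat_of_vertical (hN _) (hN _) (hf p) (hg p) (hmin _),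
      fun p hs => ?_⟩
    have := hs.sub_le (B := 2 * (4 + 4 * n)) (hN _) (hN p.castSucc) (hf p) (hg p) (α := 4 + 4 * n)
      (β := 6 + 6 * n) ?_ ?_ le_rfl (by omega)
    · exact_mod_cast this
    all_goals
      intro d hd
      obtain ⟨h₁, -, h₃⟩ := chainWeight_eq_iff.mp hd
      have := Nat.zero_le (n * d .t)
      omega
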